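/- Let $R=\mathbb{F}_2[s,s^{-1}]$ be the ring of Laurent polynomials, put $t=s^2$, and let $m\ge 0$ be an integer. Let $V$ be the free $R$-module with basis $u,v_1,\dots,v_m$, and let $q$ be the quadratic form on $V$ with $q(u)=1$, $q(v_i)=t^{-1}$ for all $i$, whose polar form $(x,y)=q(x+y)-q(x)-q(y)$ satisfies $(u,v_i)=1$ for all $i$ and $(v_i,v_j)=1$ for all $i\neq j$. Let $Cl(V,q)$ be the Clifford algebra (with $w^2=q(w)$ for $w\in V$; $R$ and $V$ are regarded as subsets of it), let $\alpha$ be its grade involution (the automorphism extending $-1_V$), and let $x\mapsto\bar x$ be Clifford conjugation, i.e. $\alpha$ composed with the anti-automorphism that reverses products of vectors. Put $$C(V,q)=\{c\in Cl(V,q)^\times : c^{-1}v\,\alpha(c)\in V\ \text{for all } v\in V\},\qquad Pin(V,q)=\{c\in C(V,q): c\bar c=1\},$$ let $Spin(V,q)$ be the set of elements of $Pin(V,q)$ lying in the even part of $Cl(V,q)$, and let $\pi:C(V,q)\to GO(V,q)$ be the natural homomorphism to the group of isometries of $(V,q)$ (acting on $V$ from the right), where $\pi(c)$ is the map $v\mapsto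 c^{-1}v\,\alpha(c)$. Put $r=u+v_1+\dots+v_m$. 1. Suppose that $m$ is even. Then the radical of the polar form is the submodule $Rr$, and $\pi$ restricted to $Pin(V,q)$ is not injective; more precisely, $$\ker\pi\cap Pin(V,q)=\begin{cases}\{1+ar:a\in R\} & \text{if } m\equiv 2\pmod 4,\\ \{1+a(1+r):a\in R\} & \text{if } m\equiv 0\pmod 4\end{cases}$$ The restriction of $\pi$ to $Spin(V,q)$ is, however, injective. 2. For every $m$, $\pi$ makes $Pin(V,q)$ a cover of its image $\pi(Pin(V,q))$, i.e. $\pi: Pin(V,q)\to\pi(Pin(V,q))$ is a surjective homomorphism whose kernel is central in $Pin(V,q)$. This cover is nontrivial, i.e. $\pi$ is not injective on $Pin(V,q)$, if and only if $m$ is even. -/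

import Mathlib

open CliffordAlgebra

noncomputable section

/-! ### Clifford group, pin group and spin group of a quadratic form on a finite free module -/

section General

variable {R : Type*} [CommRing R] {M : Type*} [AddCommGroup M] [Module R M]

/-- A free module admits a linear isomorphism of its Clifford algebra with its exterior
algebra which is the identity on vectors and on scalars (in any characteristic). -/
theorem exists_equiv_exterior [Module.Free R M] (Q : QuadraticForm R M) :
    ∃ e : CliffordAlgebra Q ≃ₗ[R] ExteriorAlgebra R M,
      (∀ v, e (ι Q v) = ExteriorAlgebra.ι R v) ∧
      ∀ a, e (algebraMap R _ a) = algebraMap R _ a := by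
  obtain ⟨B, hB⟩ := LinearMap.BilinMap.toQuadraticMap_surjective (-Q)
  have h : B.toQuadraticMap = (0 : QuadraticForm R M) - Q := by rw [hB, zero_sub]
  exact ⟨changeFormEquiv h, fun v => changeForm_ι h v, fun a => changeForm_algebraMap h a⟩

theorem clifford_ι_injective [Module.Free R M] (Q : QuadraticForm R M) :
    Function.Injective (ι Q) := by
  obtain ⟨e, he, -⟩ := exists_equiv_exterior Q
  intro v w h
  have := congrArg e h
  rw [he, he] at this
  exact ExteriorAlgebra.ι_inj R v w |>.1 this

theorem clifford_algebraMap_injective [Module.Free R M] (Q : QuadraticForm R M) :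
    Function.Injective (algebraMap R (CliffordAlgebra Q)) := by
  obtain ⟨e, -, he⟩ := exists_equiv_exterior Q
  intro v w h
  have := congrArg e h
  rw [he, he] at this
  exact (ExteriorAlgebra.algebraMap_leftInverse M).injective this

theorem clifford_finite [Module.Free R M] [Module.Finite R M] (Q : QuadraticForm R M) :
    Module.Finite R (CliffordAlgebra Q) := by
  obtain ⟨e, -, -⟩ := exists_equiv_exterior Q
  let b := Module.Free.chooseBasis R M
  classical
  let : LinearOrder (Module.Free.ChooseBasisIndex R M) := linearOrderOfSTO WellOrderingRel
  have : Module.Finite R (ExteriorAlgebra R M) := Module.Finite.of_basis b.ExteriorAlgebra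
  exact Module.Finite.equiv e.symm

/-- The linear map `x ↦ c⁻¹ x α(c)` of the Clifford algebra, `α` being the grade involution. -/
def twistedConj (Q : QuadraticForm R M) (c : (CliffordAlgebra Q)ˣ) :
    CliffordAlgebra Q →ₗ[R] CliffordAlgebra Q :=
  LinearMap.mulLeft R (↑c⁻¹ : CliffordAlgebra Q) ∘ₗ
    LinearMap.mulRight R (involute (c : CliffordAlgebra Q))

theorem twistedConj_apply (Q : QuadraticForm R M) (c : (CliffordAlgebra Q)ˣ)
    (x : CliffordAlgebra Q) :
    twistedConj Q c x = ↑c⁻¹ * x * involute (c : CliffordAlgebra Q) := by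
  simp [twistedConj, mul_assoc]

theorem twistedConj_one (Q : QuadraticForm R M) (x : CliffordAlgebra Q) :
    twistedConj Q 1 x = x := by
  simp [twistedConj_apply]

theorem twistedConj_mul (Q : QuadraticForm R M) (c d : (CliffordAlgebra Q)ˣ)
    (x : CliffordAlgebra Q) :
    twistedConj Q (c * d) x = twistedConj Q d (twistedConj Q c x) := by
  simp [twistedConj_apply, mul_assoc]

/-- Closure of the Clifford group under inverses: an ascending chain argument. -/
theorem twistedConj_inv_mem [IsNoetherianRing R] [Module.Free R M] [Module.Finite R M]
    (Q : QuadraticForm R M) (c : (CliffordAlgebra Q)ˣ)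
    (hc : ∀ v, twistedConj Q c (ι Q v) ∈ LinearMap.range (ι Q)) (v : M) :
    twistedConj Q c⁻¹ (ι Q v) ∈ LinearMap.range (ι Q) := by
  have := clifford_finite Q
  have hN : IsNoetherian R (CliffordAlgebra Q) := inferInstance
  let T : ℕ → Submodule R (CliffordAlgebra Q) := fun n =>
    (LinearMap.range (ι Q)).comap (twistedConj Q (c ^ n))
  have hstep : ∀ x ∈ LinearMap.range (ι Q), twistedConj Q c x ∈ LinearMap.range (ι Q) := by
    rintro _ ⟨w, rfl⟩
    exact hc w
  have hmono : Monotone T := monotone_nat_of_le_succ fun n x hx => by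
    change twistedConj Q (c ^ (n + 1)) x ∈ LinearMap.range (ι Q)
    rw [pow_succ, twistedConj_mul]
    exact hstep _ hx
  obtain ⟨n, hn⟩ := monotone_stabilizes_iff_noetherian.2 hN ⟨T, hmono⟩
  have h1 : T n = T (n + 1) := hn (n + 1) (Nat.le_succ n)
  have h2 : twistedConj Q (c ^ (n + 1))⁻¹ (ι Q v) ∈ T (n + 1) := by
    change twistedConj Q (c ^ (n + 1)) (twistedConj Q (c ^ (n + 1))⁻¹ (ι Q v)) ∈
      LinearMap.range (ι Q)
    rw [← twistedConj_mul, inv_mul_cancel, twistedConj_one]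
    exact ⟨v, rfl⟩
  rw [← h1] at h2
  change twistedConj Q (c ^ n) (twistedConj Q (c ^ (n + 1))⁻¹ (ι Q v)) ∈
    LinearMap.range (ι Q) at h2
  rw [← twistedConj_mul] at h2
  convert h2 using 2
  rw [pow_succ]
  group

/-- The Clifford group `C(V,q) = {c ∈ Cl(V,q)ˣ : c⁻¹ v α(c) ∈ V for all v ∈ V}`. -/
def cliffordGroup [IsNoetherianRing R] [Module.Free R M] [Module.Finite R M]
    (Q : QuadraticForm R M) : Subgroup (CliffordAlgebra Q)ˣ where
  carrier := {c | ∀ v : M,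
    ↑c⁻¹ * ι Q v * involute (c : CliffordAlgebra Q) ∈ LinearMap.range (ι Q)}
  one_mem' v := by simp
  mul_mem' {c d} hc hd v := by
    obtain ⟨w, hw⟩ := hc v
    have := hd w
    rw [hw] at this
    simpa [mul_assoc] using this
  inv_mem' {c} hc v := by
    rw [← twistedConj_apply]
    exact twistedConj_inv_mem Q c (fun w => by rw [twistedConj_apply]; exact hc w) v

/-- The orthogonal group `GO(V,q)`: all linear automorphisms preserving `q`. -/
def orthogonalGroup (Q : QuadraticForm R M) : Subgroup (M ≃ₗ[R] M) where
  carrier := {f | ∀ v, Q (f v) = Q v}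
  one_mem' _ := rfl
  mul_mem' {f g} hf hg v := (hf (g v)).trans (hg v)
  inv_mem' {f} hf v := by
    have := hf (f⁻¹ v)
    rw [← this]
    exact congrArg Q (f.apply_symm_apply v)

/-- The radical of the polar form `(·,·)` of `q`. -/
def polarRadical (Q : QuadraticForm R M) : Submodule R M := LinearMap.ker Q.polarBilin

/-- A (central) cover of groups: a surjective homomorphism with central kernel.  The cover is
trivial when the homomorphism is injective. -/
def IsGroupCover {G H : Type*} [Group G] [Group H] (f : G →* H) : Prop :=
  Function.Surjective f ∧ f.ker ≤ Subgroup.center G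

variable [IsNoetherianRing R] [Module.Free R M] [Module.Finite R M] (Q : QuadraticForm R M)

/-- For `c` in the Clifford group, the linear map `V → V`, `v ↦ c⁻¹ v α(c)`. -/
def cliffordActionLin (c : cliffordGroup Q) : M →ₗ[R] M :=
  (LinearEquiv.ofInjective (ι Q) (clifford_ι_injective Q)).symm.toLinearMap ∘ₗ
    (twistedConj Q c.1 ∘ₗ ι Q).codRestrict (LinearMap.range (ι Q))
      (fun v => by rw [LinearMap.comp_apply, twistedConj_apply]; exact c.2 v)

theorem ι_cliffordActionLin (c : cliffordGroup Q) (v : M) :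
    ι Q (cliffordActionLin Q c v) =
      ↑c.1⁻¹ * ι Q v * involute (c.1 : CliffordAlgebra Q) := by
  have h := LinearEquiv.apply_symm_apply (LinearEquiv.ofInjective (ι Q) (clifford_ι_injective Q))
    ((twistedConj Q c.1 ∘ₗ ι Q).codRestrict (LinearMap.range (ι Q))
      (fun v => by rw [LinearMap.comp_apply, twistedConj_apply]; exact c.2 v) v)
  have h' := congrArg Subtype.val h
  rw [LinearEquiv.ofInjective_apply] at h'
  exact h'.trans (twistedConj_apply Q c.1 (ι Q v))

theorem cliffordActionLin_one (v : M) : cliffordActionLin Q 1 v = v :=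
  clifford_ι_injective Q (by rw [ι_cliffordActionLin]; simp)

theorem cliffordActionLin_mul (c d : cliffordGroup Q) (v : M) :
    cliffordActionLin Q (c * d) v = cliffordActionLin Q d (cliffordActionLin Q c v) :=
  clifford_ι_injective Q (by
    rw [ι_cliffordActionLin, ι_cliffordActionLin, ι_cliffordActionLin]
    simp [mul_assoc])

theorem cliffordActionLin_isometry (c : cliffordGroup Q) (v : M) :
    Q (cliffordActionLin Q c v) = Q v := by
  apply clifford_algebraMap_injective Q
  have h1 := ι_cliffordActionLin Q c v
  have h2 : ι Q (cliffordActionLin Q c v) =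
      involute (↑c.1⁻¹ : CliffordAlgebra Q) * ι Q v * (c.1 : CliffordAlgebra Q) := by
    have := congrArg involute h1
    rw [involute_ι, map_mul, map_mul, involute_ι, involute_involute] at this
    rw [← neg_inj, this]
    noncomm_ring
  have h3 : involute (c.1 : CliffordAlgebra Q) * involute (↑c.1⁻¹ : CliffordAlgebra Q) = 1 := by
    rw [← map_mul, Units.mul_inv, map_one]
  rw [← ι_sq_scalar]
  calc ι Q (cliffordActionLin Q c v) * ι Q (cliffordActionLin Q c v)
      = (↑c.1⁻¹ * ι Q v * involute (c.1 : CliffordAlgebra Q)) *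
        (involute (↑c.1⁻¹ : CliffordAlgebra Q) * ι Q v * (c.1 : CliffordAlgebra Q)) := by
        rw [← h1, ← h2]
    _ = ↑c.1⁻¹ * ι Q v * (involute (c.1 : CliffordAlgebra Q) *
        involute (↑c.1⁻¹ : CliffordAlgebra Q)) * ι Q v * (c.1 : CliffordAlgebra Q) := by
        simp only [mul_assoc]
    _ = ↑c.1⁻¹ * (ι Q v * ι Q v) * (c.1 : CliffordAlgebra Q) := by
        rw [h3, mul_one, mul_assoc _ (ι Q v) (ι Q v)]
    _ = algebraMap R _ (Q v) := by
        rw [ι_sq_scalar, ← Algebra.commutes, mul_assoc, Units.inv_mul, mul_one]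

/-- The isometry `v ↦ c⁻¹ v α(c)` of `V` defined by `c ∈ C(V,q)`. -/
def cliffordAction (c : cliffordGroup Q) : orthogonalGroup Q :=
  ⟨LinearEquiv.ofLinearMap (cliffordActionLin Q c) (cliffordActionLin Q c⁻¹)
    (LinearMap.ext fun v => by
      simp [← cliffordActionLin_mul, cliffordActionLin_one])
    (LinearMap.ext fun v => by
      simp [← cliffordActionLin_mul, cliffordActionLin_one]),
    cliffordActionLin_isometry Q c⟩

/-- The natural homomorphism `π : C(V,q) → GO(V,q)`, `π(c)(v) = c⁻¹ v α(c)`.  With this formula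
`π(cd)` is "first `π(c)`, then `π(d)`", i.e. isometries act on `V` from the right, whence the
opposite group in the target. -/
def cliffordPi : cliffordGroup Q →* (orthogonalGroup Q)ᵐᵒᵖ where
  toFun c := MulOpposite.op (cliffordAction Q c)
  map_one' := by
    apply MulOpposite.unop_injective
    ext v
    exact cliffordActionLin_one Q v
  map_mul' c d := by
    apply MulOpposite.unop_injective
    ext v
    exact cliffordActionLin_mul Q c d v

/-- `Pin(V,q) = {c ∈ C(V,q) : c c̄ = 1}`, where `star` is Clifford conjugation `x̄ = α(xᵗʳ)`. -/
def cliffordPin : Subgroup (cliffordGroup Q) where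
  carrier := {c | (c.1 : CliffordAlgebra Q) * star (c.1 : CliffordAlgebra Q) = 1}
  one_mem' := by simp
  mul_mem' {c d} hc hd := by
    simp only [Set.mem_ofPred_eq] at hc hd
    simp only [Set.mem_ofPred_eq, Subgroup.coe_mul, Units.val_mul, star_mul]
    rw [mul_assoc, ← mul_assoc (d.1 : CliffordAlgebra Q), hd, one_mul, hc]
  inv_mem' {c} hc := by
    simp only [Set.mem_ofPred_eq] at hc ⊢
    have h : (↑c.1⁻¹ : CliffordAlgebra Q) = star (c.1 : CliffordAlgebra Q) :=
      Units.inv_eq_of_mul_eq_one_right hc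
    rw [Subgroup.coe_inv, h, star_star, ← h, Units.inv_mul]

/-- `Spin(V,q)`: the elements of `Pin(V,q)` in the even part of the Clifford algebra. -/
def cliffordSpin : Subgroup (cliffordGroup Q) where
  carrier := {c | c ∈ cliffordPin Q ∧ (c.1 : CliffordAlgebra Q) ∈ even Q}
  one_mem' := ⟨one_mem _, one_mem (even Q)⟩
  mul_mem' {c d} hc hd := ⟨mul_mem hc.1 hd.1, mul_mem hc.2 hd.2⟩
  inv_mem' {c} hc := by
    refine ⟨inv_mem hc.1, ?_⟩
    have h : (↑c.1⁻¹ : CliffordAlgebra Q) = star (c.1 : CliffordAlgebra Q) :=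
      Units.inv_eq_of_mul_eq_one_right hc.1
    rw [Subgroup.coe_inv, h, star_def]
    change reverse (involute (c.1 : CliffordAlgebra Q)) ∈ evenOdd Q 0
    rw [reverse_mem_evenOdd_iff, involute_mem_evenOdd_iff]
    exact hc.2

/-- The restriction of `π` to `Pin(V,q)`. -/
def pinPi : cliffordPin Q →* (orthogonalGroup Q)ᵐᵒᵖ :=
  (cliffordPi Q).comp (cliffordPin Q).subtype

/-- The restriction of `π` to `Spin(V,q)`. -/
def spinPi : cliffordSpin Q →* (orthogonalGroup Q)ᵐᵒᵖ :=
  (cliffordPi Q).comp (cliffordSpin Q).subtype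

/-- The set `ker π ∩ Pin(V,q)`, as a subset of the Clifford algebra. -/
def pinKernel : Set (CliffordAlgebra Q) :=
  {z | ∃ c : cliffordPin Q, c ∈ (pinPi Q).ker ∧ (c.1.1 : CliffordAlgebra Q) = z}

end General

/-! ### The ring, the module and the quadratic form -/

/-- The ring `R = 𝔽₂[s, s⁻¹]`; here `s = LaurentPolynomial.T 1`. -/
abbrev ringR : Type := LaurentPolynomial (ZMod 2)

instance ringR_isNoetherianRing : IsNoetherianRing ringR :=
  IsLocalization.isNoetherianRing (Submonoid.powers (Polynomial.X : Polynomial (ZMod 2))) ringR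
    inferInstance

/-- `t⁻¹ = s⁻²`. -/
def tInv : ringR := LaurentPolynomial.T (-2)

/-- The free module `V` of rank `m + 1` over `R`. -/
abbrev modV (m : ℕ) : Type := Fin (m + 1) → ringR

/-- The basis vector `u`. -/
def vecU (m : ℕ) : modV m := Pi.single 0 1

/-- The basis vectors `v₁, …, vₘ` (indexed by `Fin m`). -/
def vecV (m : ℕ) (i : Fin m) : modV m := Pi.single i.succ 1

/-- The quadratic form on `V` with `q(u) = 1`, `q(vᵢ) = t⁻¹`, and whose polar form takes the value
`1` on any two distinct basis vectors:
`q(x) = x₀² + ∑ᵢ t⁻¹ xᵢ² + ∑_{i < j} xᵢ xⱼ`. -/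
def formQ (m : ℕ) : QuadraticForm ringR (modV m) :=
  LinearMap.BilinMap.toQuadraticMap (Matrix.toBilin' (Matrix.of fun i j : Fin (m + 1) =>
    if i < j then (1 : ringR) else if i = j then (if i = 0 then 1 else tInv) else 0))

theorem formQ_vecU (m : ℕ) : formQ m (vecU m) = 1 := by
  simp [formQ, vecU]

theorem formQ_vecV (m : ℕ) (i : Fin m) : formQ m (vecV m i) = tInv := by
  simp [formQ, vecV]

theorem polar_formQ_vecU_vecV (m : ℕ) (i : Fin m) :
    QuadraticMap.polar (formQ m) (vecU m) (vecV m i) = 1 := by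
  simp [formQ, vecU, vecV, LinearMap.BilinMap.polar_toQuadraticMap]

theorem polar_formQ_vecV_vecV (m : ℕ) (i j : Fin m) (h : i ≠ j) :
    QuadraticMap.polar (formQ m) (vecV m i) (vecV m j) = 1 := by
  rcases lt_or_gt_of_ne h with h' | h' <;>
    simp [formQ, vecV, LinearMap.BilinMap.polar_toQuadraticMap, h', h'.ne',
      not_lt_of_gt h']

/-- The vector `r = u + v₁ + ⋯ + vₘ`. -/
def vecR (m : ℕ) : modV m := vecU m + ∑ i, vecV m i

end

open CliffordAlgebra

/-! In characteristic 2 the grade involution is trivial, so `π(c)` is ordinary conjugation and its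
kernel consists of the central elements of `C(V,q)`. This already makes the kernel central in `Pin`,
so the cover claim needs no computation.

The centre is found by contraction. The commutator with `v` is contraction by the functional
`(v,·)`, so a central element is killed by all these contractions. If some of these functionals are
dual to part of a basis and vanish on the rest, then the central element lies in the subalgebra
generated by the rest (`mem_adjoin_of_forall_contractLeft_eq_zero`). For odd `m` a full dual basis
exists and the centre is `R`. For even `m` the `vᵢ` can be removed and only `r` remains, so the
centre is `R + Rr`.

The pin condition on `a + br` reads `a² + b²q(r) = 1`. Counting pairs gives `q(r) = δ²` with `δ = 0`
or `1` according to `m` mod 4, and uniqueness of square roots in a domain of characteristic 2 forces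
`a = 1 + bδ`. The degree-one part `br` then decides both injectivity questions. -/

namespace CliffordCentre

/-! ### Contractions and subalgebras generated by vectors -/

section Contraction

variable {R : Type*} [CommRing R] {M : Type*} [AddCommGroup M] [Module R M]
  (Q : QuadraticForm R M)

/-- The twisted commutator with a vector is contraction with the polar form. -/
theorem ι_mul_sub_involute_mul_ι (v : M) (x : CliffordAlgebra Q) :
    ι Q v * x - involute x * ι Q v = contractLeft (Q.polarBilin v) x := by
  induction x using CliffordAlgebra.left_induction with
  | algebraMap r => simp [Algebra.commutes]
  | add x y hx hy => rw [map_add, map_add, ← hx, ← hy]; noncomm_ring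
  | ι_mul x w hx =>
    rw [contractLeft_ι_mul, ← hx, map_mul, involute_ι, ← mul_assoc, ι_mul_ι_comm]
    simp only [QuadraticMap.polarBilin_apply_apply, Algebra.smul_def]
    noncomm_ring

theorem contractLeft_eq_zero_of_mem_adjoin {d : Module.Dual R M} {X : Set M}
    (hX : ∀ w ∈ X, d w = 0) {x : CliffordAlgebra Q} (hx : x ∈ Algebra.adjoin R (ι Q '' X)) :
    contractLeft d x = 0 := by
  -- Left multiplication by `x` preserving the kernel of the contraction is a claim that passes to
  -- products of generators.
  suffices h : ∀ y : CliffordAlgebra Q, contractLeft d y = 0 → contractLeft d (x * y) = 0 by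
    simpa using h 1 (by simp)
  induction hx using Algebra.adjoin_induction with
  | mem x hx =>
    obtain ⟨w, hw, rfl⟩ := hx
    intro y hy
    simp [contractLeft_ι_mul, hy, hX w hw]
  | algebraMap r =>
    intro y hy
    rw [← Algebra.smul_def, map_smul, hy, smul_zero]
  | add a b _ _ ha hb =>
    intro y hy
    rw [add_mul, map_add, ha y hy, hb y hy, add_zero]
  | mul a b _ _ ha hb =>
    intro y hy
    rw [mul_assoc]
    exact ha _ (hb y hy)

/-- With `A` the subalgebra generated by `X`, the set `A + eA` contains 1 and is stable under left
multiplication by `e` (as `e² = q(e)`) and by each `w` in `X` (as `we = (w,e) - ew`). -/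
theorem exists_eq_add_ι_mul_of_mem_adjoin_insert {e : M} {X : Set M} {x : CliffordAlgebra Q}
    (hx : x ∈ Algebra.adjoin R (ι Q '' insert e X)) :
    ∃ y ∈ Algebra.adjoin R (ι Q '' X), ∃ z ∈ Algebra.adjoin R (ι Q '' X),
      x = y + ι Q e * z := by
  suffices h : ∀ y ∈ Algebra.adjoin R (ι Q '' X), ∀ z ∈ Algebra.adjoin R (ι Q '' X),
      ∃ y' ∈ Algebra.adjoin R (ι Q '' X), ∃ z' ∈ Algebra.adjoin R (ι Q '' X),
        x * (y + ι Q e * z) = y' + ι Q e * z' by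
    simpa using h 1 (one_mem _) 0 (zero_mem _)
  induction hx using Algebra.adjoin_induction with
  | mem x hx =>
    obtain ⟨w, hw, rfl⟩ := hx
    intro y hy z hz
    rcases hw with rfl | hw
    · refine ⟨Q w • z, Subalgebra.smul_mem _ hz _, y, hy, ?_⟩
      rw [mul_add, ← mul_assoc, ι_sq_scalar, Algebra.smul_def, add_comm]
    · have hw' : ι Q w ∈ Algebra.adjoin R (ι Q '' X) :=
        Algebra.subset_adjoin (Set.mem_image_of_mem _ hw)
      refine ⟨ι Q w * y + QuadraticMap.polar Q w e • z,
        add_mem (mul_mem hw' hy) (Subalgebra.smul_mem _ hz _), -(ι Q w * z),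
        neg_mem (mul_mem hw' hz), ?_⟩
      rw [mul_add, ← mul_assoc, ι_mul_ι_comm, Algebra.smul_def]
      noncomm_ring
  | algebraMap r =>
    intro y hy z hz
    refine ⟨r • y, Subalgebra.smul_mem _ hy _, r • z, Subalgebra.smul_mem _ hz _, ?_⟩
    rw [← Algebra.smul_def, smul_add, mul_smul_comm]
  | add a b _ _ ha hb =>
    intro y hy z hz
    obtain ⟨y₁, hy₁, z₁, hz₁, h₁⟩ := ha y hy z hz
    obtain ⟨y₂, hy₂, z₂, hz₂, h₂⟩ := hb y hy z hz
    refine ⟨y₁ + y₂, add_mem hy₁ hy₂, z₁ + z₂, add_mem hz₁ hz₂, ?_⟩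
    rw [add_mul, h₁, h₂]
    noncomm_ring
  | mul a b _ _ ha hb =>
    intro y hy z hz
    obtain ⟨y₁, hy₁, z₁, hz₁, h₁⟩ := hb y hy z hz
    rw [mul_assoc, h₁]
    exact ha _ hy₁ _ hz₁

/-- Contracting `y + ez` by `d` returns `z`, so vanishing of the contraction removes the `e` term.
-/
theorem mem_adjoin_of_contractLeft_eq_zero {d : Module.Dual R M} {e : M} {X : Set M}
    (he : d e = 1) (hX : ∀ w ∈ X, d w = 0) {x : CliffordAlgebra Q}
    (hx : x ∈ Algebra.adjoin R (ι Q '' insert e X)) (hd : contractLeft d x = 0) :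
    x ∈ Algebra.adjoin R (ι Q '' X) := by
  obtain ⟨y, hy, z, hz, rfl⟩ := exists_eq_add_ι_mul_of_mem_adjoin_insert Q hx
  rw [map_add, contractLeft_ι_mul, contractLeft_eq_zero_of_mem_adjoin Q hX hy,
    contractLeft_eq_zero_of_mem_adjoin Q hX hz, he] at hd
  have hz0 : z = 0 := by simpa using hd
  simpa [hz0] using hy

theorem mem_adjoin_of_forall_contractLeft_eq_zero {κ : Type*} [DecidableEq κ] {e : κ → M}
    {d : κ → Module.Dual R M} {X : Set M} (hde : ∀ i j, d i (e j) = if i = j then 1 else 0)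
    (hX : ∀ i, ∀ w ∈ X, d i w = 0) {x : CliffordAlgebra Q} (hd : ∀ i, contractLeft (d i) x = 0)
    (T : Finset κ) (hx : x ∈ Algebra.adjoin R (ι Q '' (e '' T ∪ X))) :
    x ∈ Algebra.adjoin R (ι Q '' X) := by
  induction T using Finset.induction_on with
  | empty => simpa using hx
  | insert i T hi ih =>
    refine ih (mem_adjoin_of_contractLeft_eq_zero Q (d := d i) (e := e i) ?_ ?_ ?_ (hd i))
    · simp [hde]
    · rintro w (⟨j, hj, rfl⟩ | hw)
      · rw [hde, if_neg]
        rintro rfl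
        exact hi hj
      · exact hX i w hw
    · rwa [Finset.coe_insert, Set.image_insert_eq, Set.insert_union] at hx

theorem adjoin_ι_image_eq_top {X : Set M} (hX : Submodule.span R X = ⊤) :
    Algebra.adjoin R (ι Q '' X) = ⊤ := by
  rw [eq_top_iff, ← adjoin_range_ι]
  refine Algebra.adjoin_le ?_
  rintro _ ⟨v, rfl⟩
  have hv : ι Q v ∈ (Submodule.span R X).map (ι Q) :=
    Submodule.mem_map_of_mem (hX ▸ Submodule.mem_top)
  rw [Submodule.map_span] at hv
  exact Algebra.span_le_adjoin R _ hv

theorem exists_eq_of_mem_adjoin_singleton {r : M} {x : CliffordAlgebra Q}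
    (hx : x ∈ Algebra.adjoin R (ι Q '' {r})) :
    ∃ a b : R, x = algebraMap R _ a + b • ι Q r := by
  rw [← insert_empty_eq r] at hx
  obtain ⟨y, hy, z, hz, rfl⟩ := exists_eq_add_ι_mul_of_mem_adjoin_insert Q hx
  rw [Set.image_empty, Algebra.adjoin_empty, Algebra.mem_bot] at hy hz
  obtain ⟨a, rfl⟩ := hy
  obtain ⟨b, rfl⟩ := hz
  exact ⟨a, b, by rw [Algebra.smul_def, Algebra.commutes]⟩

theorem commute_of_forall_ι {c : CliffordAlgebra Q} (hc : ∀ v, ι Q v * c = c * ι Q v)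
    (x : CliffordAlgebra Q) : x * c = c * x := by
  induction x using CliffordAlgebra.left_induction with
  | algebraMap r => exact Algebra.commutes r c
  | add x y hx hy => rw [add_mul, mul_add, hx, hy]
  | ι_mul x w hx => rw [mul_assoc, hx, ← mul_assoc, hc, mul_assoc]

theorem eq_zero_of_ι_mem_even [Module.Free R M] {v : M} (h : ι Q v ∈ even Q) : v = 0 := by
  have h1 : ι Q v ∈ evenOdd Q 0 ⊓ evenOdd Q 1 := ⟨h, ι_mem_evenOdd_one Q v⟩
  rw [(evenOdd_isCompl (Q := Q)).inf_eq_bot, Submodule.mem_bot] at h1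
  exact clifford_ι_injective Q (by rw [h1, map_zero])

/-- The odd component of the element is `ar`. This serves both injectivity on `Spin` and, since 1 is
even, non-injectivity on `Pin`. -/
theorem smul_eq_zero_of_mem_even [Module.Free R M] {Q : QuadraticForm R M} (δ a : R) {r : M}
    (h : (1 : CliffordAlgebra Q) + a • (algebraMap R _ δ + ι Q r) ∈ even Q) : a • r = 0 := by
  apply eq_zero_of_ι_mem_even Q
  have h1 : (1 : CliffordAlgebra Q) + a • algebraMap R _ δ ∈ even Q :=
    add_mem (one_mem _) (Subalgebra.smul_mem _ (Subalgebra.algebraMap_mem _ _) _)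
  have h2 := sub_mem h h1
  rwa [smul_add, ← add_assoc, add_sub_cancel_left, ← map_smul] at h2

theorem pinPi_injective_iff [IsNoetherianRing R] [Module.Free R M] [Module.Finite R M] :
    Function.Injective (pinPi Q) ↔ pinKernel Q ⊆ {1} := by
  rw [injective_iff_map_eq_one]
  constructor
  · rintro h _ ⟨c, hc, rfl⟩
    rw [h c hc]
    rfl
  · intro h c hc
    exact Subtype.ext (Subtype.ext (Units.ext (h ⟨c, hc, rfl⟩)))

end Contraction

/-! ### Injectivity read off from the shape of the kernel -/

section Kernel

variable {R : Type*} [CommRing R] [IsNoetherianRing R] {M : Type*} [AddCommGroup M]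
  [Module R M] [Module.Free R M] [Module.Finite R M] {Q : QuadraticForm R M}

theorem spinPi_injective [IsDomain R] {r : M} {δ : R}
    (hK : pinKernel Q = {z | ∃ a : R, z = 1 + a • (algebraMap R _ δ + ι Q r)})
    (hr : r ≠ 0) : Function.Injective (spinPi Q) := by
  rw [injective_iff_map_eq_one]
  intro c hc
  have h : (c.1.1 : CliffordAlgebra Q) ∈ pinKernel Q := ⟨⟨c.1, c.2.1⟩, hc, rfl⟩
  rw [hK] at h
  obtain ⟨a, ha⟩ := h
  have h2 := c.2.2
  rw [ha] at h2
  have h3 : a = 0 := (smul_eq_zero.1 (smul_eq_zero_of_mem_even δ a h2)).resolve_right hr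
  rw [h3, zero_smul, add_zero] at ha
  exact Subtype.ext (Subtype.ext (Units.ext ha))

theorem not_pinPi_injective {r : M} {δ : R}
    (hK : pinKernel Q = {z | ∃ a : R, z = 1 + a • (algebraMap R _ δ + ι Q r)})
    (hr : r ≠ 0) : ¬ Function.Injective (pinPi Q) := by
  rw [pinPi_injective_iff, hK]
  intro h
  have h1 : (1 : CliffordAlgebra Q) + (1 : R) • (algebraMap R _ δ + ι Q r) = 1 := h ⟨1, rfl⟩
  have h2 := smul_eq_zero_of_mem_even (Q := Q) δ 1 (by rw [h1]; exact one_mem _)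
  exact hr (by simpa using h2)

end Kernel

/-! ### Characteristic 2: the kernel of `π` as the central elements of norm 1 -/

section CharTwo

variable {R : Type*} [CommRing R] [CharP R 2] {M : Type*} [AddCommGroup M] [Module R M]
  (Q : QuadraticForm R M)

theorem add_self_eq_zero_of_charTwo (R : Type*) [CommRing R] [CharP R 2] {M : Type*}
    [AddCommGroup M] [Module R M] (x : M) : x + x = 0 := by
  rw [← two_smul R x, CharTwo.two_eq_zero, zero_smul]

theorem involute_eq_self (x : CliffordAlgebra Q) : involute x = x := by
  have : (involute : CliffordAlgebra Q →ₐ[R] CliffordAlgebra Q) = AlgHom.id R _ := by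
    ext v
    simp only [LinearMap.comp_apply, AlgHom.toLinearMap_apply,
      involute_ι, AlgHom.id_apply]
    exact neg_eq_of_add_eq_zero_left (add_self_eq_zero_of_charTwo R _)
  rw [this, AlgHom.id_apply]

theorem contractLeft_polar_eq_zero {c : CliffordAlgebra Q} {v : M}
    (hc : ι Q v * c = c * ι Q v) : contractLeft (Q.polarBilin v) c = 0 := by
  rw [← ι_mul_sub_involute_mul_ι, involute_eq_self, hc, sub_self]

theorem ι_mul_comm_of_mem_polarRadical {r : M} (hr : r ∈ polarRadical Q) (v : M) :
    ι Q v * ι Q r = ι Q r * ι Q v := by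
  have h : QuadraticMap.polar Q r v = 0 := by
    simpa using LinearMap.congr_fun (LinearMap.mem_ker.1 hr) v
  have h2 := ι_mul_ι_add_swap (Q := Q) r v
  rw [h, map_zero] at h2
  rw [eq_neg_of_add_eq_zero_right h2]
  exact neg_eq_of_add_eq_zero_left (add_self_eq_zero_of_charTwo R _)

theorem star_algebraMap_add_smul_ι (a b : R) (r : M) :
    star (algebraMap R (CliffordAlgebra Q) a + b • ι Q r) = algebraMap R _ a + b • ι Q r := by
  rw [star_def, involute_eq_self]
  simp

theorem algebraMap_add_smul_ι_mul_self (a b : R) (r : M) :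
    (algebraMap R (CliffordAlgebra Q) a + b • ι Q r) * (algebraMap R _ a + b • ι Q r) =
      algebraMap R _ (a ^ 2 + b ^ 2 * Q r) := by
  have h : a • b • ι Q r + a • b • ι Q r = 0 := add_self_eq_zero_of_charTwo R _
  rw [add_mul, mul_add, mul_add, ← Algebra.commutes a (b • ι Q r), ← Algebra.smul_def,
    ← Algebra.smul_def, smul_mul_smul_comm, ι_sq_scalar, add_assoc,
    ← add_assoc (a • b • ι Q r), h, zero_add]
  simp [pow_two, Algebra.smul_def]

variable [IsNoetherianRing R] [Module.Free R M] [Module.Finite R M]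

theorem mem_ker_cliffordPi_iff (c : cliffordGroup Q) :
    c ∈ (cliffordPi Q).ker ↔
      ∀ v, ι Q v * (c.1 : CliffordAlgebra Q) = (c.1 : CliffordAlgebra Q) * ι Q v := by
  have key : ∀ v, cliffordActionLin Q c v = v ↔
      ι Q v * (c.1 : CliffordAlgebra Q) = (c.1 : CliffordAlgebra Q) * ι Q v := fun v => by
    rw [← (clifford_ι_injective Q).eq_iff, ι_cliffordActionLin, involute_eq_self, mul_assoc,
      Units.inv_mul_eq_iff_eq_mul]
  rw [MonoidHom.mem_ker]
  constructor
  · intro h v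
    rw [← key]
    have h1 : cliffordAction Q c = 1 := MulOpposite.op_injective h
    exact congrArg (fun f : orthogonalGroup Q => f.1 v) h1
  · intro h
    apply MulOpposite.unop_injective
    ext v
    exact (key v).2 (h v)

/-- A central `z` of norm 1 is automatically in the Clifford group: `star z` is its two-sided
inverse by centrality, and conjugation by `z` fixes every vector. -/
theorem mem_pinKernel_iff (z : CliffordAlgebra Q) :
    z ∈ pinKernel Q ↔ (∀ v, ι Q v * z = z * ι Q v) ∧ z * star z = 1 := by
  constructor
  · rintro ⟨c, hc, rfl⟩
    exact ⟨(mem_ker_cliffordPi_iff Q c.1).1 hc, c.2⟩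
  · rintro ⟨h, h1⟩
    have h2 : star z * z = 1 := by rw [commute_of_forall_ι Q h, h1]
    let c : (CliffordAlgebra Q)ˣ := ⟨z, star z, h1, h2⟩
    have hc : c ∈ cliffordGroup Q := fun v => by
      rw [involute_eq_self, mul_assoc, h v, Units.inv_mul_cancel_left]
      exact ⟨v, rfl⟩
    exact ⟨⟨⟨c, hc⟩, h1⟩, (mem_ker_cliffordPi_iff Q ⟨c, hc⟩).2 h, rfl⟩

theorem isGroupCover_pinPi : IsGroupCover (pinPi Q).rangeRestrict := by
  refine ⟨MonoidHom.rangeRestrict_surjective _, fun c hc => ?_⟩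
  rw [MonoidHom.ker_rangeRestrict] at hc
  have h := (mem_ker_cliffordPi_iff Q c.1).1 hc
  rw [Subgroup.mem_center_iff]
  intro d
  exact Subtype.ext (Subtype.ext (Units.ext (commute_of_forall_ι Q h _)))

end CharTwo

/-! ### The pin kernel when the centre is `R + Rr` -/

section Centre

variable {R : Type*} [CommRing R] [IsDomain R] [CharP R 2] [IsNoetherianRing R]
  {M : Type*} [AddCommGroup M] [Module R M] [Module.Free R M] [Module.Finite R M]
  {Q : QuadraticForm R M}

/-- When `q(r) = δ²`, the norm of `a + br` is the perfect square `(a + bδ)²`. Squaring is injective,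
so norm 1 means `a = 1 + bδ`. The parameter `δ` treats both residues of `m` mod 4 at once. -/
theorem pinKernel_eq {r : M} {δ : R} (hr : r ∈ polarRadical Q) (hδ : Q r = δ ^ 2)
    (hZ : ∀ z : CliffordAlgebra Q, (∀ v, ι Q v * z = z * ι Q v) →
      ∃ a b : R, z = algebraMap R _ a + b • ι Q r) :
    pinKernel Q = {z | ∃ a : R, z = 1 + a • (algebraMap R _ δ + ι Q r)} := by
  have norm_eq (a b : R) : a ^ 2 + b ^ 2 * Q r = (a + b * δ) ^ 2 := by
    rw [CharTwo.add_sq, hδ, mul_pow]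
  ext z
  rw [mem_pinKernel_iff, Set.mem_ofPred_eq]
  constructor
  · rintro ⟨h, h1⟩
    obtain ⟨a, b, rfl⟩ := hZ z h
    rw [star_algebraMap_add_smul_ι, algebraMap_add_smul_ι_mul_self, norm_eq,
      ← map_one (algebraMap R (CliffordAlgebra Q))] at h1
    have h2 := clifford_algebraMap_injective Q h1
    have h3 : a + b * δ = 1 := by
      rw [← CharTwo.sq_inj, h2, one_pow]
    refine ⟨b, ?_⟩
    have h4 : a = 1 + b * δ := by rw [← h3, add_assoc, CharTwo.add_self_eq_zero, add_zero]
    rw [h4, map_add, map_one, smul_add, add_assoc, map_mul, Algebra.smul_def b (algebraMap R _ δ)]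
  · rintro ⟨b, rfl⟩
    have e : (1 : CliffordAlgebra Q) + b • (algebraMap R _ δ + ι Q r) =
        algebraMap R _ (1 + b * δ) + b • ι Q r := by
      rw [map_add, map_one, smul_add, add_assoc, map_mul,
        Algebra.smul_def b (algebraMap R _ δ)]
    rw [e]
    refine ⟨fun v => ?_, ?_⟩
    · rw [mul_add, add_mul, Algebra.commutes, mul_smul_comm, smul_mul_assoc,
        ι_mul_comm_of_mem_polarRadical Q hr]
    · rw [star_algebraMap_add_smul_ι, algebraMap_add_smul_ι_mul_self, norm_eq, add_assoc,
        CharTwo.add_self_eq_zero, add_zero, one_pow, map_one]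

end Centre

/-! ### The form `q`: radical, value at `r`, and centre -/

section FormQ

instance : CharP ringR 2 :=
  charP_of_injective_algebraMap (algebraMap (ZMod 2) ringR).injective 2

variable {m : ℕ}

theorem polarBilin_formQ_single (i j : Fin (m + 1)) :
    (formQ m).polarBilin (Pi.single i 1) (Pi.single j 1) = if i = j then 0 else 1 := by
  rcases lt_trichotomy i j with h | rfl | h
  · simp [formQ, LinearMap.BilinMap.polar_toQuadraticMap, h, h.ne, h.ne', h.not_gt]
  · rw [QuadraticMap.polarBilin_apply_apply, QuadraticMap.polar_self, two_nsmul,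
      CharTwo.add_self_eq_zero, if_pos rfl]
  · simp [formQ, LinearMap.BilinMap.polar_toQuadraticMap, h, h.ne', h.not_gt]

theorem polarBilin_formQ_apply_single (v : modV m) (j : Fin (m + 1)) :
    (formQ m).polarBilin v (Pi.single j 1) = ∑ i, v i + v j := by
  conv_lhs => rw [pi_eq_sum_univ' v]
  simp only [map_sum, map_smul, LinearMap.sum_apply, LinearMap.smul_apply,
    polarBilin_formQ_single, smul_eq_mul]
  have h (i : Fin (m + 1)) : v i * (if i = j then 0 else 1) = v i + if i = j then v i else 0 := by
    split_ifs <;> simp [CharTwo.add_self_eq_zero]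
  simp [h, Finset.sum_add_distrib]

theorem vecR_apply (i : Fin (m + 1)) : vecR m i = 1 := by
  refine Fin.cases ?_ (fun i => ?_) i <;>
    simp [vecR, vecU, vecV, Finset.sum_apply, Pi.single_apply, Fin.succ_inj]

theorem vecR_ne_zero : vecR m ≠ 0 := fun h => by
  have := congrFun h 0
  rw [vecR_apply] at this
  exact one_ne_zero this

theorem mem_polarRadical_formQ_iff (v : modV m) :
    v ∈ polarRadical (formQ m) ↔ ∀ j, v j = ∑ i, v i := by
  rw [polarRadical, LinearMap.mem_ker]
  constructor
  · intro h j
    have h1 := polarBilin_formQ_apply_single v j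
    rw [h, LinearMap.zero_apply] at h1
    exact (CharTwo.add_eq_zero.1 h1.symm).symm
  · intro h
    refine LinearMap.pi_ext' fun j => LinearMap.ext_ring ?_
    simp only [LinearMap.comp_apply, LinearMap.single_apply, LinearMap.zero_apply]
    rw [polarBilin_formQ_apply_single, ← h j, CharTwo.add_self_eq_zero]

theorem polarRadical_formQ (hm : Even m) :
    polarRadical (formQ m) = Submodule.span ringR {vecR m} := by
  ext v
  rw [mem_polarRadical_formQ_iff, Submodule.mem_span_singleton]
  constructor
  · intro h
    exact ⟨∑ i, v i, funext fun j => by simp [vecR_apply, h j]⟩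
  · rintro ⟨a, rfl⟩ j
    have h1 : ((m : ℕ) : ringR) = 0 := (CharP.cast_eq_zero_iff ringR 2 m).2 hm.two_dvd
    simp [vecR_apply, h1]

/-- All coordinates of `r` are 1, so `q(r)` is the sum of all matrix entries: the diagonal, plus one
for each pair `i < j`. -/
theorem formQ_vecR : formQ m (vecR m) = 1 + m * tInv + ((m + 1).choose 2 : ℕ) := by
  have hM (i j : Fin (m + 1)) : (if i < j then (1 : ringR) else
      if i = j then (if i = 0 then 1 else tInv) else 0) =
      (if i < j then 1 else 0) + if i = j then (if i = 0 then 1 else tInv) else 0 := by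
    split_ifs with h h' <;> simp_all
  have hcard : ∑ i : Fin (m + 1), ∑ j : Fin (m + 1), (if i < j then (1 : ringR) else 0) =
      ((m + 1).choose 2 : ℕ) := by
    rw [Finset.sum_comm]
    simp only [Finset.sum_boole, Finset.filter_gt_eq_Iio, Fin.card_Iio]
    rw [← Nat.cast_sum, Fin.sum_univ_eq_sum_range (fun i => i), Finset.sum_range_id,
      Nat.choose_two_right]
  have hdiag : ∑ i : Fin (m + 1), (if i = 0 then (1 : ringR) else tInv) = 1 + m * tInv := by
    simp [Fin.sum_univ_succ]
  simp only [formQ, LinearMap.BilinMap.toQuadraticMap_apply, Matrix.toBilin'_apply, vecR_apply,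
    Matrix.of_apply, one_mul, mul_one, hM, Finset.sum_add_distrib, hcard, Finset.sum_ite_eq,
    Finset.mem_univ, if_true, hdiag]
  rw [add_comm]

/-- The vectors `vᵢ + u` have polar functionals `w ↦ wᵢ + w₀`, which are dual to the `vᵢ` and vanish
on `r`. Since `r, v₁, …, vₘ` span `V`, only `r` survives. Parity of `m` plays no role. -/
theorem exists_eq_of_commute {z : CliffordAlgebra (formQ m)}
    (hz : ∀ v, ι (formQ m) v * z = z * ι (formQ m) v) :
    ∃ a b : ringR, z = algebraMap ringR _ a + b • ι (formQ m) (vecR m) := by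
  -- The coordinate sum of `vᵢ + u` is `1 + 1 = 0`, so the polar functional just reads off the
  -- vector's own coordinates.
  have hpol (i : Fin m) (j : Fin (m + 1)) :
      (formQ m).polarBilin (vecV m i + vecU m) (Pi.single j 1) =
        (vecV m i + vecU m) j := by
    rw [polarBilin_formQ_apply_single]
    simp [vecV, vecU, Finset.sum_add_distrib, CharTwo.add_self_eq_zero]
  have hval (i : Fin m) (w : modV m) :
      (formQ m).polarBilin (vecV m i + vecU m) w = w i.succ + w 0 := by
    conv_lhs => rw [pi_eq_sum_univ' w]
    simp only [map_sum, map_smul, hpol, smul_eq_mul]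
    simp [vecV, vecU, mul_add, Finset.sum_add_distrib, Pi.single_apply]
  apply exists_eq_of_mem_adjoin_singleton
  refine mem_adjoin_of_forall_contractLeft_eq_zero (formQ m) (e := vecV m)
    (d := fun i => (formQ m).polarBilin (vecV m i + vecU m)) ?_ ?_
    (fun i => contractLeft_polar_eq_zero _ (hz _)) Finset.univ ?_
  · intro i j
    rw [hval]
    simp [vecV, Pi.single_apply, Fin.succ_inj]
  · rintro i w rfl
    rw [hval]
    simp [vecR_apply, CharTwo.add_self_eq_zero]
  · rw [adjoin_ι_image_eq_top]
    · trivial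
    · rw [eq_top_iff]
      intro v _
      have hv : v = v 0 • vecR m + ∑ i, (v i.succ + v 0) • vecV m i := by
        funext j
        refine Fin.cases ?_ (fun j => ?_) j
        · simp [vecR_apply, vecV, Finset.sum_apply]
        · simp [vecR_apply, vecV, Finset.sum_apply, Pi.single_apply, Fin.succ_inj,
            add_left_comm, CharTwo.add_self_eq_zero]
      rw [hv]
      refine add_mem (Submodule.smul_mem _ _ (Submodule.subset_span (by simp)))
        (sum_mem fun i _ => Submodule.smul_mem _ _ (Submodule.subset_span (by simp)))

/-- For odd `m` the polar form is nondegenerate: `r` plus the `i`-th basis vector has coordinate sum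
`(m + 1) + 1 = 1`, so its functional takes the value `1 + 1 + δᵢⱼ = δᵢⱼ` on the `j`-th. Every basis
vector can thus be removed, leaving scalars. -/
theorem exists_eq_algebraMap_of_commute (hm : Odd m) {z : CliffordAlgebra (formQ m)}
    (hz : ∀ v, ι (formQ m) v * z = z * ι (formQ m) v) :
    ∃ a : ringR, z = algebraMap ringR _ a := by
  have h1 : ((m : ℕ) : ringR) + 1 = 0 := by
    rw [← Nat.cast_succ]
    exact (CharP.cast_eq_zero_iff ringR 2 (m + 1)).2 hm.add_one.two_dvd
  suffices h : z ∈ Algebra.adjoin ringR (ι (formQ m) '' (∅ : Set (modV m))) by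
    rw [Set.image_empty, Algebra.adjoin_empty, Algebra.mem_bot] at h
    obtain ⟨a, rfl⟩ := h
    exact ⟨a, rfl⟩
  refine mem_adjoin_of_forall_contractLeft_eq_zero (formQ m)
    (e := fun i : Fin (m + 1) => Pi.single i 1)
    (d := fun i => (formQ m).polarBilin (vecR m + Pi.single i 1)) ?_ (by simp)
    (fun i => contractLeft_polar_eq_zero _ (hz _)) Finset.univ ?_
  · intro i j
    rw [polarBilin_formQ_apply_single]
    simp only [Pi.add_apply, vecR_apply, Finset.sum_add_distrib]
    simp [Pi.single_apply, h1, ← add_assoc, CharTwo.add_self_eq_zero, eq_comm]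
  · rw [adjoin_ι_image_eq_top]
    · trivial
    · rw [eq_top_iff]
      intro v _
      rw [pi_eq_sum_univ' v]
      exact sum_mem fun i _ => Submodule.smul_mem _ _ (Submodule.subset_span (by simp))

theorem pinPi_formQ_injective_of_odd (hm : Odd m) : Function.Injective (pinPi (formQ m)) := by
  rw [pinPi_injective_iff]
  intro z hz
  obtain ⟨h, h1⟩ := (mem_pinKernel_iff _ z).1 hz
  obtain ⟨a, rfl⟩ := exists_eq_algebraMap_of_commute hm h
  rw [star_algebraMap, ← map_mul, ← map_one (algebraMap ringR (CliffordAlgebra (formQ m)))] at h1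
  have h2 : a ^ 2 = 1 ^ 2 := by
    rw [pow_two, one_pow, clifford_algebraMap_injective (formQ m) h1]
  rw [CharTwo.sq_inj.1 h2, map_one]
  rfl

theorem vecR_mem_polarRadical (hm : Even m) : vecR m ∈ polarRadical (formQ m) := by
  rw [polarRadical_formQ hm]
  exact Submodule.mem_span_singleton_self _

theorem formQ_vecR_of_two_mod_four (hm : m ≡ 2 [MOD 4]) : formQ m (vecR m) = 0 := by
  obtain ⟨k, rfl⟩ : ∃ k, m = 4 * k + 2 := ⟨m / 4, by have : m % 4 = 2 := hm; omega⟩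
  have h1 : ((4 * k + 2 : ℕ) : ringR) = 0 :=
    (CharP.cast_eq_zero_iff ringR 2 _).2 ⟨2 * k + 1, by ring⟩
  have h2 : (4 * k + 2 + 1).choose 2 = 2 * (4 * k ^ 2 + 5 * k + 1) + 1 := by
    rw [Nat.choose_two_right, Nat.add_sub_cancel]
    exact Nat.div_eq_of_eq_mul_left two_pos (by ring)
  rw [formQ_vecR, h1, h2]
  push_cast
  linear_combination (4 * (k : ringR) ^ 2 + 5 * k + 2) * CharTwo.two_eq_zero (R := ringR)

theorem formQ_vecR_of_zero_mod_four (hm : m ≡ 0 [MOD 4]) : formQ m (vecR m) = 1 := by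
  obtain ⟨k, rfl⟩ : ∃ k, m = 4 * k := ⟨m / 4, by have : m % 4 = 0 := hm; omega⟩
  have h1 : ((4 * k : ℕ) : ringR) = 0 :=
    (CharP.cast_eq_zero_iff ringR 2 _).2 ⟨2 * k, by ring⟩
  have h2 : (4 * k + 1).choose 2 = 2 * (4 * k ^ 2 + k) := by
    rw [Nat.choose_two_right, Nat.add_sub_cancel]
    exact Nat.div_eq_of_eq_mul_left two_pos (by ring)
  rw [formQ_vecR, h1, h2]
  push_cast
  linear_combination (4 * (k : ringR) ^ 2 + k) * CharTwo.two_eq_zero (R := ringR)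

theorem pinKernel_formQ_of_two_mod_four (hm : m ≡ 2 [MOD 4]) : pinKernel (formQ m) =
    {z | ∃ a : ringR, z = 1 + a • ι (formQ m) (vecR m)} := by
  have he : Even m := by rw [Nat.even_iff]; have : m % 4 = 2 := hm; omega
  have h := pinKernel_eq (Q := formQ m) (δ := 0) (vecR_mem_polarRadical he)
    (by rw [formQ_vecR_of_two_mod_four hm, zero_pow two_ne_zero])
    (fun z hz => exists_eq_of_commute hz)
  simpa only [map_zero, zero_add] using h

theorem pinKernel_formQ_of_zero_mod_four (hm : m ≡ 0 [MOD 4]) : pinKernel (formQ m) =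
    {z | ∃ a : ringR, z = 1 + a • (1 + ι (formQ m) (vecR m))} := by
  have he : Even m := by rw [Nat.even_iff]; have : m % 4 = 0 := hm; omega
  have h := pinKernel_eq (Q := formQ m) (δ := 1) (vecR_mem_polarRadical he)
    (by rw [formQ_vecR_of_zero_mod_four hm, one_pow])
    (fun z hz => exists_eq_of_commute hz)
  simpa only [map_one] using h

theorem exists_pinKernel_formQ (hm : Even m) : ∃ δ : ringR, pinKernel (formQ m) =
    {z | ∃ a : ringR, z = 1 + a • (algebraMap ringR _ δ + ι (formQ m) (vecR m))} := by
  have h : m % 4 = 2 ∨ m % 4 = 0 := by have := Nat.even_iff.1 hm; omega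
  rcases h with h | h
  · exact ⟨0, by simpa only [map_zero, zero_add] using pinKernel_formQ_of_two_mod_four h⟩
  · exact ⟨1, by simpa only [map_one] using pinKernel_formQ_of_zero_mod_four h⟩

end FormQ

end CliffordCentre

open CliffordCentre in
theorem mainTheorem10 (m : ℕ) :
    (Even m →
      polarRadical (formQ m) = Submodule.span ringR {vecR m} ∧
      ¬ Function.Injective (pinPi (formQ m)) ∧
      (m ≡ 2 [MOD 4] → pinKernel (formQ m) =
        {z | ∃ a : ringR, z = 1 + a • ι (formQ m) (vecR m)}) ∧
      (m ≡ 0 [MOD 4] → pinKernel (formQ m) =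
        {z | ∃ a : ringR, z = 1 + a • (1 + ι (formQ m) (vecR m))}) ∧
      Function.Injective (spinPi (formQ m))) ∧
    IsGroupCover (pinPi (formQ m)).rangeRestrict ∧
    (¬ Function.Injective (pinPi (formQ m)).rangeRestrict ↔ Even m) := by
  have hinj : Function.Injective (pinPi (formQ m)).rangeRestrict ↔
      Function.Injective (pinPi (formQ m)) := by
    rw [← MonoidHom.ker_eq_bot_iff, MonoidHom.ker_rangeRestrict, MonoidHom.ker_eq_bot_iff]
  refine ⟨fun hm => ?_, isGroupCover_pinPi _, ?_⟩
  · obtain ⟨δ, hδ⟩ := exists_pinKernel_formQ hm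
    exact ⟨polarRadical_formQ hm, not_pinPi_injective hδ vecR_ne_zero,
      pinKernel_formQ_of_two_mod_four, pinKernel_formQ_of_zero_mod_four,
      spinPi_injective hδ vecR_ne_zero⟩
  · rw [hinj]
    refine ⟨fun h => ?_, fun hm => ?_⟩
    · by_contra hm
      exact h (pinPi_formQ_injective_of_odd (Nat.not_even_iff_odd.1 hm))
    · obtain ⟨δ, hδ⟩ := exists_pinKernel_formQ hm
      exact not_pinPi_injective hδ vecR_ne_zero
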